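/- Theorem 3. Let $A$ be a finite alphabet, let $\alpha$ be an infinite word over $A$ and let $k\ge 0$ be an integer. The following are equivalent. (1) $\alpha$ is a morphic word with growth $\Theta(n^k)$. That is, there are a finite alphabet $C$, a morphism $h:C^*\to C^*$, a letter $c\in C$ and a coding $\tau:C^*\to A^*$ (a morphism with $|\tau(d)|=1$ for every letter $d\in C$) such that $h(c)=cx$ for some string $x\in C^*$ with $h^m(x)\neq\lambda$ for all $m\ge 0$ (where $\lambda$ is the empty string), $\alpha=\tau(h^\omega(c))$ with $h^\omega(c)=c\,x\,h(x)\,h^2(x)\cdots$, and $|h^n(c)|\in\Theta(n^k)$ as $n\to\infty$. (2) $\alpha$ is a zigzag word of depth $k$. That is, $\alpha=q\,R(l,1)\,R(l,2)\,R(l,3)\cdots$ for some string $q\in A^*$ (possibly empty) and some $l\in L$ with $\operatorname{depth}(l)=k$. Here $L$ is the smallest set containing all lists $[(f_1,x_1),\dots,(f_m,x_m)]$ with $m\ge 1$ such that, for each $j$, either $f_j\in\{F,B\}$ and $x_j\in L$, or $f_j=S$ and $x_j$ is a nonempty string over $A$. For $l=[(f_1,x_1),\dots,(f_m,x_m)]\in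 L$ and $n\ge 1$, $$R(l,n)=f_1(x_1,n)\,f_2(x_2,n)\cdots f_m(x_m,n),$$ where $$F(x,n)=R(x,1)R(x,2)\cdots R(x,n),\qquad B(x,n)=R(x,n)\cdots R(x,2)R(x,1),\qquad S(r,n)=r,$$ and $\operatorname{depth}(l)$ is the maximum over $1\le j\le m$ of the number that is $1$ if $f_j=S$ and $\operatorname{depth}(x_j)+1$ if $f_j\in\{F,B\}$. -/

import Mathlib

open Filter Asymptotics

universe u

namespace ZigzagWords

/-! Strings over `A` are the elements of `FreeMonoid A`, concatenation is the product, and the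
empty string is `1`.  Infinite words are functions on `ℕ` (the first letter has index `0`). -/

/-- Infinite words over `A`. -/
abbrev InfWord (A : Type*) := ℕ → A

/-- The string `x` is a prefix of the infinite word `α`. -/
def IsPrefixOf {A : Type*} (x : FreeMonoid A) (α : InfWord A) : Prop :=
  x.toList = (List.range x.length).map α

/-- The infinite word `α` is the infinite concatenation `q · w 0 · w 1 · w 2 ⋯`: every finite
partial concatenation is a prefix of `α`, and the partial concatenations are arbitrarily long. -/
def IsInfConcat {A : Type*} (q : FreeMonoid A) (w : ℕ → FreeMonoid A) (α : InfWord A) : Prop :=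
  (∀ n : ℕ, IsPrefixOf (q * ((List.range n).map w).prod) α) ∧
    ∀ N : ℕ, ∃ n : ℕ, N ≤ (q * ((List.range n).map w).prod).length

/-! ### Morphic words -/

/-- The string `x` is mortal for the morphism `h`. -/
def IsMortal {C : Type*} (h : FreeMonoid C →* FreeMonoid C) (x : FreeMonoid C) : Prop :=
  ∃ m : ℕ, h^[m] x = 1

/-- The morphism `h` is prolongable on the letter `c`. -/
def IsProlongable {C : Type*} (h : FreeMonoid C →* FreeMonoid C) (c : C) : Prop :=
  ∃ x : FreeMonoid C, h (FreeMonoid.of c) = FreeMonoid.of c * x ∧ ¬ IsMortal h x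

/-- `β` is the infinite word `h^ω(c) = c x h(x) h²(x) ⋯`, where `h(c) = c x`. -/
def IsOmegaLimit {C : Type*} (h : FreeMonoid C →* FreeMonoid C) (c : C) (β : InfWord C) : Prop :=
  ∃ x : FreeMonoid C, h (FreeMonoid.of c) = FreeMonoid.of c * x ∧
    IsInfConcat (FreeMonoid.of c) (fun i => h^[i] x) β

/-- A coding: a morphism sending every letter to a string of length one. -/
def IsCoding {C A : Type*} (τ : FreeMonoid C →* FreeMonoid A) : Prop :=
  ∀ d : C, (τ (FreeMonoid.of d)).length = 1

/-- `(h, c, τ)` is a representation of the infinite word `α` as a morphic word, that is, `h` is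
prolongable on `c`, `τ` is a coding and `α = τ(h^ω(c))` (where `τ` acts letter by letter). -/
def IsMorphicRepr {C A : Type*} (h : FreeMonoid C →* FreeMonoid C) (c : C)
    (τ : FreeMonoid C →* FreeMonoid A) (α : InfWord A) : Prop :=
  IsProlongable h c ∧ IsCoding τ ∧
    ∃ β : InfWord C, IsOmegaLimit h c β ∧
      ∀ i : ℕ, τ (FreeMonoid.of (β i)) = FreeMonoid.of (α i)

/-- `α` is a morphic word with growth `f`: it has a representation `(h, c, τ)`, over some finite
alphabet `C`, such that `|hⁿ(c)| = f n` for all `n`. -/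
def IsMorphicWithGrowth {A : Type*} (f : ℕ → ℕ) (α : InfWord A) : Prop :=
  ∃ (C : Type) (_ : Finite C) (h : FreeMonoid C →* FreeMonoid C) (c : C)
    (τ : FreeMonoid C →* FreeMonoid A),
    IsMorphicRepr h c τ α ∧ ∀ n : ℕ, (h^[n] (FreeMonoid.of c)).length = f n

/-- `f ∈ Θ(n^k)`. -/
def IsThetaPow (f : ℕ → ℕ) (k : ℕ) : Prop :=
  (fun n : ℕ => (f n : ℝ)) =Θ[atTop] (fun n : ℕ => (n : ℝ) ^ k)

/-! ### Zigzag words -/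

mutual
  /-- The terms `(F, l)`, `(B, l)` with `l` in `L`, and `(S, r)` with `r` a nonempty string. -/
  inductive ZTerm (A : Type u) where
    | F : ZList A → ZTerm A
    | B : ZList A → ZTerm A
    | S : (r : FreeMonoid A) → r ≠ 1 → ZTerm A
  /-- The set `L`: nonempty lists of terms. -/
  inductive ZList (A : Type u) where
    | single : ZTerm A → ZList A
    | cons : ZTerm A → ZList A → ZList A
end

mutual
  /-- `f(x, n)` for a term `(f, x)`: `F(l, n) = R(l, 1) ⋯ R(l, n)`, `B(l, n) = R(l, n) ⋯ R(l, 1)`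
  and `S(r, n) = r`. -/
  def ZTerm.eval {A : Type*} : ZTerm A → ℕ → FreeMonoid A
    | .F l, n => ((List.range n).map (fun i => l.R (i + 1))).prod
    | .B l, n => ((List.range n).reverse.map (fun i => l.R (i + 1))).prod
    | .S r _, _ => r
  /-- `R([(f₁, x₁), …, (fₘ, xₘ)], n) = f₁(x₁, n) ⋯ fₘ(xₘ, n)`; only values at `n ≥ 1` matter. -/
  def ZList.R {A : Type*} : ZList A → ℕ → FreeMonoid A
    | .single t, n => t.eval n
    | .cons t l, n => t.eval n * l.R n
end

mutual
  /-- The depth of a term. -/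
  def ZTerm.depth {A : Type*} : ZTerm A → ℕ
    | .F l => l.depth + 1
    | .B l => l.depth + 1
    | .S _ _ => 1
  /-- The depth of a list: the maximum of the depths of its terms. -/
  def ZList.depth {A : Type*} : ZList A → ℕ
    | .single t => t.depth
    | .cons t l => max t.depth l.depth
end

/-- `α` is a zigzag word of depth `k`: `α = q · R(l, 1) · R(l, 2) ⋯` for some string `q` and some
`l` in `L` of depth `k`. -/
def IsZigzagOfDepth {A : Type*} (k : ℕ) (α : InfWord A) : Prop :=
  ∃ (q : FreeMonoid A) (l : ZList A), IsInfConcat q (fun i => l.R (i + 1)) α ∧ l.depth = k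

end ZigzagWords

namespace ZigzagWords

section Products

variable {M N : Type*} [Monoid M] [Monoid N]

/-- The product `w 0 * w 1 * ⋯ * w (n - 1)`. -/
def fwdProd (w : ℕ → M) (n : ℕ) : M := ((List.range n).map w).prod

/-- The product `w (n - 1) * ⋯ * w 1 * w 0`. -/
def bwdProd (w : ℕ → M) (n : ℕ) : M := ((List.range n).reverse.map w).prod

@[simp] theorem fwdProd_zero (w : ℕ → M) : fwdProd w 0 = 1 := rfl

@[simp] theorem bwdProd_zero (w : ℕ → M) : bwdProd w 0 = 1 := rfl

theorem fwdProd_succ (w : ℕ → M) (n : ℕ) : fwdProd w (n + 1) = fwdProd w n * w n := by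
  simp [fwdProd, List.range_succ]

theorem bwdProd_succ (w : ℕ → M) (n : ℕ) : bwdProd w (n + 1) = w n * bwdProd w n := by
  simp [bwdProd, List.range_succ]

theorem fwdProd_succ_left (w : ℕ → M) (n : ℕ) :
    fwdProd w (n + 1) = w 0 * fwdProd (fun i => w (i + 1)) n := by
  induction n with
  | zero => simp [fwdProd_succ]
  | succ n ih => rw [fwdProd_succ, ih, fwdProd_succ, mul_assoc]

theorem bwdProd_succ_right (w : ℕ → M) (n : ℕ) :
    bwdProd w (n + 1) = bwdProd (fun i => w (i + 1)) n * w 0 := by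
  induction n with
  | zero => simp [bwdProd_succ]
  | succ n ih => rw [bwdProd_succ, ih, bwdProd_succ, mul_assoc]

theorem fwdProd_add (w : ℕ → M) (m n : ℕ) :
    fwdProd w (m + n) = fwdProd w m * fwdProd (fun i => w (m + i)) n := by
  induction n with
  | zero => simp
  | succ n ih => rw [← add_assoc, fwdProd_succ, ih, fwdProd_succ, mul_assoc]

theorem bwdProd_add (w : ℕ → M) (m n : ℕ) :
    bwdProd w (m + n) = bwdProd (fun i => w (m + i)) n * bwdProd w m := by
  induction n with
  | zero => simp
  | succ n ih => rw [← add_assoc, bwdProd_succ, ih, bwdProd_succ, mul_assoc]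

theorem fwdProd_const_one (n : ℕ) : fwdProd (fun _ => (1 : M)) n = 1 := by
  simp [fwdProd]

theorem bwdProd_const_one (n : ℕ) : bwdProd (fun _ => (1 : M)) n = 1 := by
  simp [bwdProd]

theorem map_fwdProd (φ : M →* N) (w : ℕ → M) (n : ℕ) :
    φ (fwdProd w n) = fwdProd (fun i => φ (w i)) n := by
  simp [fwdProd, map_list_prod, Function.comp_def]

theorem map_bwdProd (φ : M →* N) (w : ℕ → M) (n : ℕ) :
    φ (bwdProd w n) = bwdProd (fun i => φ (w i)) n := by
  simp [bwdProd, map_list_prod, Function.comp_def]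

theorem length_fwdProd {A : Type*} (w : ℕ → FreeMonoid A) (n : ℕ) :
    (fwdProd w n).length = ∑ i ∈ Finset.range n, (w i).length := by
  induction n with
  | zero => rfl
  | succ n ih => rw [fwdProd_succ, FreeMonoid.length_mul, ih, Finset.sum_range_succ]

theorem length_bwdProd {A : Type*} (w : ℕ → FreeMonoid A) (n : ℕ) :
    (bwdProd w n).length = ∑ i ∈ Finset.range n, (w i).length := by
  induction n with
  | zero => rfl
  | succ n ih =>
    rw [bwdProd_succ, FreeMonoid.length_mul, ih, Finset.sum_range_succ, add_comm]

end Products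

theorem ZTerm.eval_F {A : Type*} (l : ZList A) (n : ℕ) :
    (ZTerm.F l).eval n = fwdProd (fun i => l.R (i + 1)) n := by
  rw [ZTerm.eval]; rfl

theorem ZTerm.eval_B {A : Type*} (l : ZList A) (n : ℕ) :
    (ZTerm.B l).eval n = bwdProd (fun i => l.R (i + 1)) n := by
  rw [ZTerm.eval]; rfl

/-! ### Lengths -/

theorem succ_pow_succ_le (d n : ℕ) : (n + 1) ^ (d + 1) ≤ n ^ (d + 1) + (d + 1) * (n + 1) ^ d := by
  induction d with
  | zero => simp
  | succ d ih =>
    have h : n ^ (d + 1) ≤ (n + 1) ^ (d + 1) := Nat.pow_le_pow_left (Nat.le_succ n) _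
    calc (n + 1) ^ (d + 1 + 1) = (n + 1) * (n + 1) ^ (d + 1) := by ring
      _ ≤ (n + 1) * (n ^ (d + 1) + (d + 1) * (n + 1) ^ d) := Nat.mul_le_mul_left _ ih
      _ = n ^ (d + 1 + 1) + (n ^ (d + 1) + (d + 1) * (n + 1) ^ (d + 1)) := by ring
      _ ≤ n ^ (d + 1 + 1) + ((n + 1) ^ (d + 1) + (d + 1) * (n + 1) ^ (d + 1)) := by gcongr
      _ = n ^ (d + 1 + 1) + (d + 1 + 1) * (n + 1) ^ (d + 1) := by ring

theorem pow_succ_le_sum (d n : ℕ) :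
    n ^ (d + 1) ≤ (d + 1) * ∑ i ∈ Finset.range n, (i + 1) ^ d := by
  induction n with
  | zero => simp
  | succ n ih =>
    rw [Finset.sum_range_succ, mul_add]
    exact (succ_pow_succ_le d n).trans (by gcongr)

theorem sum_le_pow_succ (d n : ℕ) : ∑ i ∈ Finset.range n, (i + 1) ^ d ≤ n ^ (d + 1) := by
  calc ∑ i ∈ Finset.range n, (i + 1) ^ d ≤ ∑ _i ∈ Finset.range n, n ^ d := by
        refine Finset.sum_le_sum fun i hi => Nat.pow_le_pow_left ?_ _
        exact Finset.mem_range.1 hi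
    _ = n ^ (d + 1) := by simp [pow_succ, mul_comm]

theorem sum_bounds {d a : ℕ} {s : ℕ → ℕ}
    (hs : ∀ n, (n + 1) ^ d ≤ a * s n ∧ s n ≤ a * (n + 1) ^ d) (n : ℕ) :
    n ^ (d + 1) ≤ (d + 1) * a * ∑ i ∈ Finset.range n, s i ∧
      ∑ i ∈ Finset.range n, s i ≤ (d + 1) * a * n ^ (d + 1) := by
  constructor
  · calc n ^ (d + 1) ≤ (d + 1) * ∑ i ∈ Finset.range n, (i + 1) ^ d := pow_succ_le_sum d n
      _ ≤ (d + 1) * ∑ i ∈ Finset.range n, a * s i := by gcongr with i; exact (hs i).1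
      _ = _ := by rw [← Finset.mul_sum, mul_assoc]
  · calc ∑ i ∈ Finset.range n, s i ≤ ∑ i ∈ Finset.range n, a * (i + 1) ^ d :=
          Finset.sum_le_sum fun i _ => (hs i).2
      _ = a * ∑ i ∈ Finset.range n, (i + 1) ^ d := by rw [Finset.mul_sum]
      _ ≤ a * n ^ (d + 1) := by gcongr; exact sum_le_pow_succ d n
      _ ≤ _ := by
        gcongr
        exact Nat.le_mul_of_pos_left _ d.succ_pos

mutual

theorem ZTerm.length_bounds {A : Type*} : ∀ t : ZTerm A, ∃ d a, t.depth = d + 1 ∧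
    ∀ n, (n + 1) ^ d ≤ a * (t.eval (n + 1)).length ∧ (t.eval (n + 1)).length ≤ a * (n + 1) ^ d
  | .F l => by
    obtain ⟨d, a, hd, h⟩ := ZList.length_bounds l
    refine ⟨d + 1, (d + 1) * a, by rw [ZTerm.depth, hd], fun n => ?_⟩
    rw [ZTerm.eval_F, length_fwdProd]
    exact sum_bounds h (n + 1)
  | .B l => by
    obtain ⟨d, a, hd, h⟩ := ZList.length_bounds l
    refine ⟨d + 1, (d + 1) * a, by rw [ZTerm.depth, hd], fun n => ?_⟩
    rw [ZTerm.eval_B, length_bwdProd]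
    exact sum_bounds h (n + 1)
  | .S r hr => by
    have : 0 < r.length := Nat.pos_of_ne_zero fun h => hr (FreeMonoid.length_eq_zero.1 h)
    refine ⟨0, r.length, by rw [ZTerm.depth], fun n => ?_⟩
    rw [ZTerm.eval, pow_zero]
    exact ⟨Nat.mul_pos this this, by simp⟩

theorem ZList.length_bounds {A : Type*} : ∀ l : ZList A, ∃ d a, l.depth = d + 1 ∧
    ∀ n, (n + 1) ^ d ≤ a * (l.R (n + 1)).length ∧ (l.R (n + 1)).length ≤ a * (n + 1) ^ d
  | .single t => by
    obtain ⟨d, a, hd, h⟩ := ZTerm.length_bounds t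
    refine ⟨d, a, by rw [ZList.depth, hd], fun n => ?_⟩
    rw [ZList.R]
    exact h n
  | .cons t l => by
    obtain ⟨d, a, hd, h⟩ := ZTerm.length_bounds t
    obtain ⟨e, b, he, h'⟩ := ZList.length_bounds l
    refine ⟨max d e, a + b, by rw [ZList.depth, hd, he, Nat.add_max_add_right], fun n => ?_⟩
    rw [ZList.R, FreeMonoid.length_mul]
    constructor
    · rcases le_total d e with hde | hde
      · rw [max_eq_right hde]
        exact (h' n).1.trans (Nat.mul_le_mul (Nat.le_add_left _ _) (Nat.le_add_left _ _))
      · rw [max_eq_left hde]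
        exact (h n).1.trans (Nat.mul_le_mul (Nat.le_add_right _ _) (Nat.le_add_right _ _))
    · rw [add_mul]
      refine add_le_add ((h n).2.trans ?_) ((h' n).2.trans ?_)
      · exact Nat.mul_le_mul_left _ (Nat.pow_le_pow_right n.succ_pos (le_max_left _ _))
      · exact Nat.mul_le_mul_left _ (Nat.pow_le_pow_right n.succ_pos (le_max_right _ _))

end

theorem ZList.R_succ_ne_one {A : Type*} (l : ZList A) (n : ℕ) : l.R (n + 1) ≠ 1 := by
  obtain ⟨d, a, -, h⟩ := l.length_bounds
  intro h1
  have := (h n).1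
  rw [h1, FreeMonoid.length_one, mul_zero] at this
  exact absurd this (Nat.not_le.2 (by positivity))

/-- The length of `R(l, 1) ⋯ R(l, n)` is of order `n ^ depth l`. -/
theorem ZList.length_fwdProd_bounds {A : Type*} (l : ZList A) : ∃ a, ∀ n,
    n ^ l.depth ≤ a * (fwdProd (fun i => l.R (i + 1)) n).length ∧
      (fwdProd (fun i => l.R (i + 1)) n).length ≤ a * n ^ l.depth := by
  obtain ⟨d, a, hd, h⟩ := l.length_bounds
  refine ⟨(d + 1) * a, fun n => ?_⟩
  rw [hd, length_fwdProd]
  exact sum_bounds h n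

/-! ### Polynomial orders of growth -/

theorem IsThetaPow.exists_bounds {f : ℕ → ℕ} {k : ℕ} (h : IsThetaPow f k) :
    ∃ K N : ℕ, ∀ n ≥ N, f n ≤ K * n ^ k ∧ n ^ k ≤ K * f n := by
  obtain ⟨c₁, h₁⟩ := h.1.bound
  obtain ⟨c₂, h₂⟩ := h.2.bound
  obtain ⟨N, hN⟩ := eventually_atTop.1 (h₁.and h₂)
  obtain ⟨K, hK⟩ := exists_nat_ge (max c₁ c₂)
  refine ⟨K, N, fun n hn => ?_⟩
  obtain ⟨e₁, e₂⟩ := hN n hn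
  simp only [norm_pow, RCLike.norm_natCast] at e₁ e₂
  constructor
  · have : (f n : ℝ) ≤ K * (n : ℝ) ^ k :=
      e₁.trans (by gcongr; exact (le_max_left _ _).trans hK)
    exact_mod_cast this
  · have : (n : ℝ) ^ k ≤ K * (f n : ℝ) :=
      e₂.trans (by gcongr; exact (le_max_right _ _).trans hK)
    exact_mod_cast this

theorem isThetaPow_of_bounds {f : ℕ → ℕ} {k K : ℕ}
    (h : ∀ n ≥ 1, f n ≤ K * n ^ k ∧ n ^ k ≤ K * f n) : IsThetaPow f k := by
  constructor
  · refine IsBigO.of_bound K (eventually_atTop.2 ⟨1, fun n hn => ?_⟩)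
    simp only [norm_pow, RCLike.norm_natCast]
    exact_mod_cast (h n hn).1
  · refine IsBigO.of_bound K (eventually_atTop.2 ⟨1, fun n hn => ?_⟩)
    simp only [norm_pow, RCLike.norm_natCast]
    exact_mod_cast (h n hn).2

theorem le_of_pow_le_mul_pow {i j K N : ℕ} (h : ∀ n ≥ N, n ^ i ≤ K * n ^ j) : i ≤ j := by
  by_contra! hij
  have h₁ := h (K + 1 + N) (Nat.le_add_left _ _)
  have h₂ : (K + 1 + N) ^ (j + 1) ≤ (K + 1 + N) ^ i := Nat.pow_le_pow_right (by omega) hij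
  have h₃ : (K + 1 + N) * (K + 1 + N) ^ j ≤ K * (K + 1 + N) ^ j := by
    rw [← pow_succ']; exact h₂.trans h₁
  have := Nat.le_of_mul_le_mul_right h₃ (Nat.pow_pos (by omega))
  omega

theorem exists_mul_pow_lt_two_pow (K k : ℕ) : ∃ j ≥ 1, K * j ^ k < 2 ^ j := by
  have h := tendsto_pow_const_div_const_pow_of_one_lt k (one_lt_two : (1 : ℝ) < 2)
  have h' : ∀ᶠ j : ℕ in atTop, (j : ℝ) ^ k / 2 ^ j < 1 / (K + 1) :=
    h.eventually_lt_const (by positivity)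
  obtain ⟨j, hj, hj1⟩ := (h'.and (eventually_ge_atTop 1)).exists
  refine ⟨j, hj1, ?_⟩
  rw [div_lt_div_iff₀ (by positivity) (by positivity)] at hj
  have : (j : ℝ) ^ k * (K + 1) < 2 ^ j := by linarith
  have h2 : j ^ k * (K + 1) < 2 ^ j := by exact_mod_cast this
  nlinarith [Nat.zero_le (j ^ k)]

/-! ### Prefixes and infinite concatenations -/

theorem isPrefixOf_iff {A : Type*} {x : FreeMonoid A} {α : InfWord A} :
    IsPrefixOf x α ↔ ∀ i (hi : i < x.toList.length), x.toList[i] = α i := by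
  constructor
  · intro h i hi
    have : x.toList[i]? = ((List.range x.length).map α)[i]? := congrArg (fun l : List A => l[i]?) h
    rw [List.getElem?_eq_getElem hi, List.getElem?_map,
      List.getElem?_eq_getElem (by simpa [FreeMonoid.length] using hi)] at this
    simpa using this
  · intro h
    refine List.ext_getElem (by simp [FreeMonoid.length]) fun i h₁ h₂ => ?_
    rw [h i h₁]
    simp

theorem IsPrefixOf.of_mul {A : Type*} {x y : FreeMonoid A} {α : InfWord A}
    (h : IsPrefixOf (x * y) α) : IsPrefixOf x α := by
  rw [isPrefixOf_iff] at h ⊢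
  intro i hi
  have hi' : i < (x * y).toList.length := by
    rw [FreeMonoid.toList_mul, List.length_append]; omega
  rw [← h i hi']
  simp only [FreeMonoid.toList_mul]
  rw [List.getElem_append_left hi]

theorem IsPrefixOf.map {A B : Type*} {x : FreeMonoid A} {α : InfWord A} (h : IsPrefixOf x α)
    {t : A → B} {β : InfWord B} (ht : ∀ i, t (α i) = β i) :
    IsPrefixOf (FreeMonoid.map t x) β := by
  rw [isPrefixOf_iff] at h ⊢
  intro i hi
  simp only [FreeMonoid.toList_map, List.getElem_map]
  rw [h, ht]

theorem isInfConcat_iff {A : Type*} {q : FreeMonoid A} {w : ℕ → FreeMonoid A} {α : InfWord A} :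
    IsInfConcat q w α ↔ (∀ n, IsPrefixOf (q * fwdProd w n) α) ∧
      ∀ N : ℕ, ∃ n, N ≤ (q * fwdProd w n).length :=
  Iff.rfl

theorem IsInfConcat.shift {A : Type*} {q : FreeMonoid A} {w : ℕ → FreeMonoid A} {α : InfWord A}
    (h : IsInfConcat q w α) : IsInfConcat (q * w 0) (fun i => w (i + 1)) α := by
  rw [isInfConcat_iff] at h ⊢
  have e : ∀ n, q * w 0 * fwdProd (fun i => w (i + 1)) n = q * fwdProd w (n + 1) := fun n => by
    rw [fwdProd_succ_left, mul_assoc]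
  refine ⟨fun n => e n ▸ h.1 (n + 1), fun N => ?_⟩
  obtain ⟨n, hn⟩ := h.2 N
  refine ⟨n, hn.trans ?_⟩
  rw [e, fwdProd_succ, ← mul_assoc, FreeMonoid.length_mul _ (w n)]
  exact Nat.le_add_right _ _

theorem le_length_fwdProd {A : Type*} {w : ℕ → FreeMonoid A} (hw : ∀ i, w i ≠ 1) (n : ℕ) :
    n ≤ (fwdProd w n).length := by
  induction n with
  | zero => simp
  | succ n ih =>
    have := Nat.pos_of_ne_zero fun h => hw n (FreeMonoid.length_eq_zero.1 h)
    rw [fwdProd_succ, FreeMonoid.length_mul]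
    omega

theorem exists_isInfConcat {A : Type*} (q : FreeMonoid A) {w : ℕ → FreeMonoid A}
    (hw : ∀ i, w i ≠ 1) : ∃ α, IsInfConcat q w α := by
  have hlen : ∀ n, n ≤ (q * fwdProd w n).length := fun n => by
    rw [FreeMonoid.length_mul]
    exact (le_length_fwdProd hw n).trans (Nat.le_add_left _ _)
  refine ⟨fun i => (q * fwdProd w (i + 1)).toList[i]'(hlen (i + 1)), ?_⟩
  rw [isInfConcat_iff]
  refine ⟨fun n => isPrefixOf_iff.2 fun i hi => ?_, fun N => ⟨N, hlen N⟩⟩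
  have key : ∀ m n i (h₁ : i < (q * fwdProd w m).toList.length)
      (h₂ : i < (q * fwdProd w n).toList.length), m ≤ n →
      (q * fwdProd w m).toList[i] = (q * fwdProd w n).toList[i] := by
    intro m n i h₁ h₂ hmn
    obtain ⟨s, rfl⟩ := Nat.exists_eq_add_of_le hmn
    simp only [fwdProd_add w m s, ← mul_assoc]
    simp only [FreeMonoid.toList_mul _ (fwdProd (fun i => w (m + i)) s)]
    rw [List.getElem_append_left h₁]
  rcases le_total n (i + 1) with h | h
  · exact key _ _ _ _ _ h
  · exact (key _ _ _ _ _ h).symm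

/-! ### Sequences of strings generated by morphisms -/

/-- The sequence `w` is the image under a coding of the sequence `X, h X, h² X, …` for a morphism
`h` over a finite alphabet. -/
def IsGenerated {A : Type*} (w : ℕ → FreeMonoid A) : Prop :=
  ∃ (C : Type) (_ : Finite C) (h : FreeMonoid C →* FreeMonoid C) (t : C → A) (X : FreeMonoid C),
    ∀ i, FreeMonoid.map t (h^[i] X) = w i

theorem exists_map_fin_eq {A : Type*} (r : FreeMonoid A) :
    ∃ (m : ℕ) (t : Fin m → A) (r' : FreeMonoid (Fin m)), FreeMonoid.map t r' = r :=
  ⟨r.toList.length, r.toList.get, FreeMonoid.ofList (List.finRange _), by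
    rw [← FreeMonoid.ofList_map, List.map_get_finRange, FreeMonoid.ofList_toList]⟩

theorem isGenerated_const {A : Type*} (r : FreeMonoid A) : IsGenerated (fun _ => r) := by
  obtain ⟨m, t, r', hr⟩ := exists_map_fin_eq r
  exact ⟨Fin m, inferInstance, MonoidHom.id _, t, r', fun i => by simp [hr]⟩

theorem IsGenerated.shift {A : Type*} {w : ℕ → FreeMonoid A} (hw : IsGenerated w) :
    IsGenerated (fun i => w (i + 1)) := by
  obtain ⟨C, hC, h, t, X, H⟩ := hw
  exact ⟨C, hC, h, t, h X, fun i => H (i + 1)⟩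

/-- If `f` intertwines `h` and `g` on letters, then it intertwines their iterates. -/
theorem iterate_map_of_semiconj {C D : Type*} {f : C → D} {h : FreeMonoid C →* FreeMonoid C}
    {g : FreeMonoid D →* FreeMonoid D}
    (H : ∀ c, g (FreeMonoid.of (f c)) = FreeMonoid.map f (h (FreeMonoid.of c)))
    (n : ℕ) (z : FreeMonoid C) : g^[n] (FreeMonoid.map f z) = FreeMonoid.map f (h^[n] z) := by
  have e : ∀ z, g (FreeMonoid.map f z) = FreeMonoid.map f (h z) := fun z =>
    DFunLike.congr_fun (FreeMonoid.hom_eq H :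
      g.comp (FreeMonoid.map f) = (FreeMonoid.map f).comp h) z
  exact (Function.Semiconj.iterate_right (fun z => (e z).symm) n z).symm

theorem IsGenerated.exists_common {A : Type*} {v w : ℕ → FreeMonoid A} (hv : IsGenerated v)
    (hw : IsGenerated w) :
    ∃ (C : Type) (_ : Finite C) (h : FreeMonoid C →* FreeMonoid C) (t : C → A)
      (X Z : FreeMonoid C), (∀ i, FreeMonoid.map t (h^[i] X) = v i) ∧
        ∀ i, FreeMonoid.map t (h^[i] Z) = w i := by
  obtain ⟨C, hC, h, t, X, H⟩ := hv
  obtain ⟨D, hD, g, s, Y, G⟩ := hw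
  refine ⟨C ⊕ D, inferInstance,
    FreeMonoid.lift (Sum.elim (fun c => FreeMonoid.map Sum.inl (h (FreeMonoid.of c)))
      fun d => FreeMonoid.map Sum.inr (g (FreeMonoid.of d))),
    Sum.elim t s, FreeMonoid.map Sum.inl X, FreeMonoid.map Sum.inr Y, fun i => ?_, fun i => ?_⟩
  · rw [iterate_map_of_semiconj (h := h) (fun c => by simp), FreeMonoid.map_map,
      Sum.elim_comp_inl, H]
  · rw [iterate_map_of_semiconj (h := g) (fun c => by simp), FreeMonoid.map_map,
      Sum.elim_comp_inr, G]

theorem IsGenerated.mul {A : Type*} {v w : ℕ → FreeMonoid A} (hv : IsGenerated v)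
    (hw : IsGenerated w) : IsGenerated (fun i => v i * w i) := by
  obtain ⟨C, hC, h, t, X, Z, H, G⟩ := hv.exists_common hw
  exact ⟨C, hC, h, t, X * Z, fun i => by rw [iterate_map_mul, map_mul, H, G]⟩

section Marker

variable {C D : Type*} (h : FreeMonoid C →* FreeMonoid C) (q : FreeMonoid D) (X Z : FreeMonoid C)

/-- The morphism that sends the additional letter `none` to `X none q Z`, acts as `h` on `C`, and
erases the letters in `D`. -/
def markerHom : FreeMonoid (Option (C ⊕ D)) →* FreeMonoid (Option (C ⊕ D)) :=
  FreeMonoid.lift fun o => o.elim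
    (FreeMonoid.map (some ∘ Sum.inl) X * FreeMonoid.of none *
      FreeMonoid.map (some ∘ Sum.inr) q * FreeMonoid.map (some ∘ Sum.inl) Z)
    (Sum.elim (fun c => FreeMonoid.map (some ∘ Sum.inl) (h (FreeMonoid.of c))) fun _ => 1)

theorem markerHom_none : markerHom h q X Z (FreeMonoid.of none) =
    FreeMonoid.map (some ∘ Sum.inl) X * FreeMonoid.of none *
      FreeMonoid.map (some ∘ Sum.inr) q * FreeMonoid.map (some ∘ Sum.inl) Z :=
  rfl

theorem iterate_markerHom_inl (n : ℕ) (z : FreeMonoid C) :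
    (markerHom h q X Z)^[n] (FreeMonoid.map (some ∘ Sum.inl) z) =
      FreeMonoid.map (some ∘ Sum.inl) (h^[n] z) :=
  iterate_map_of_semiconj (fun _ => rfl) n z

theorem markerHom_inr (z : FreeMonoid D) :
    markerHom h q X Z (FreeMonoid.map (some ∘ Sum.inr) z) = 1 :=
  DFunLike.congr_fun (FreeMonoid.hom_eq (fun _ => rfl) :
    (markerHom h q X Z).comp (FreeMonoid.map (some ∘ Sum.inr)) = 1) z

theorem iterate_markerHom (n : ℕ) :
    (markerHom h q X Z)^[n] (FreeMonoid.of none * FreeMonoid.map (some ∘ Sum.inr) q) =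
      bwdProd (fun i => FreeMonoid.map (some ∘ Sum.inl) (h^[i] X)) n *
        (FreeMonoid.of none * FreeMonoid.map (some ∘ Sum.inr) q) *
      fwdProd (fun i => FreeMonoid.map (some ∘ Sum.inl) (h^[i] Z)) n := by
  induction n with
  | zero => simp
  | succ n ih =>
    rw [Function.iterate_succ_apply, map_mul, markerHom_inr, markerHom_none, mul_one,
      iterate_map_mul, mul_assoc (FreeMonoid.map _ X), iterate_map_mul, ih,
      iterate_markerHom_inl, iterate_markerHom_inl, bwdProd_succ, fwdProd_succ]
    simp only [mul_assoc]

/-- The coding that extends `t` and `s` and sends the marker to `a`. -/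
def markerCoding {A : Type*} (t : C → A) (s : D → A) (a : A) : Option (C ⊕ D) → A :=
  fun o => o.elim a (Sum.elim t s)

variable {A : Type*} (t : C → A) (s : D → A) (a : A)

theorem map_markerCoding_inl (z : FreeMonoid C) :
    FreeMonoid.map (markerCoding t s a) (FreeMonoid.map (some ∘ Sum.inl) z) =
      FreeMonoid.map t z :=
  FreeMonoid.map_map

theorem map_markerCoding_inr (z : FreeMonoid D) :
    FreeMonoid.map (markerCoding t s a) (FreeMonoid.map (some ∘ Sum.inr) z) =
      FreeMonoid.map s z :=
  FreeMonoid.map_map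

theorem map_iterate_markerHom (n : ℕ) :
    FreeMonoid.map (markerCoding t s a) ((markerHom h q X Z)^[n]
        (FreeMonoid.of none * FreeMonoid.map (some ∘ Sum.inr) q)) =
      bwdProd (fun i => FreeMonoid.map t (h^[i] X)) n * (FreeMonoid.of a * FreeMonoid.map s q) *
        fwdProd (fun i => FreeMonoid.map t (h^[i] Z)) n := by
  rw [iterate_markerHom, map_mul, map_mul, map_mul, map_bwdProd, map_fwdProd,
    map_markerCoding_inr]
  simp only [map_markerCoding_inl]
  rfl

end Marker

theorem exists_map_fin_of_mul_eq {A : Type*} {r : FreeMonoid A} (hr : r ≠ 1) :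
    ∃ (m : ℕ) (s : Fin m → A) (a : A) (q : FreeMonoid (Fin m)),
      FreeMonoid.of a * FreeMonoid.map s q = r := by
  cases r using FreeMonoid.casesOn with
  | one => exact absurd rfl hr
  | of_mul a r =>
    obtain ⟨m, s, q, rfl⟩ := exists_map_fin_eq r
    exact ⟨m, s, a, q, rfl⟩

theorem IsGenerated.bwdProd_mul_fwdProd {A : Type*} {v w : ℕ → FreeMonoid A} {r : FreeMonoid A}
    (hv : IsGenerated v) (hw : IsGenerated w) (hr : r ≠ 1) :
    IsGenerated (fun n => bwdProd v n * r * fwdProd w n) := by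
  obtain ⟨C, hC, h, t, X, Z, H, G⟩ := hv.exists_common hw
  obtain ⟨m, s, a, q, rfl⟩ := exists_map_fin_of_mul_eq hr
  refine ⟨Option (C ⊕ Fin m), inferInstance, markerHom h q X Z, markerCoding t s a, _,
    fun n => (map_iterate_markerHom h q X Z t s a n).trans ?_⟩
  simp only [H, G]

theorem IsGenerated.fwdProd_succ {A : Type*} {w : ℕ → FreeMonoid A} (hw : IsGenerated w)
    (h0 : w 0 ≠ 1) : IsGenerated (fun n => fwdProd w (n + 1)) := by
  have := (isGenerated_const (1 : FreeMonoid A)).bwdProd_mul_fwdProd hw.shift h0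
  simpa only [bwdProd_const_one, one_mul, ← fwdProd_succ_left] using this

theorem IsGenerated.bwdProd_succ {A : Type*} {w : ℕ → FreeMonoid A} (hw : IsGenerated w)
    (h0 : w 0 ≠ 1) : IsGenerated (fun n => bwdProd w (n + 1)) := by
  have := hw.shift.bwdProd_mul_fwdProd (isGenerated_const (1 : FreeMonoid A)) h0
  simpa only [fwdProd_const_one, mul_one, ← bwdProd_succ_right] using this

mutual

theorem ZTerm.isGenerated {A : Type*} : ∀ t : ZTerm A, IsGenerated (fun n => t.eval (n + 1))
  | .F l => by
    simp only [ZTerm.eval_F]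
    exact (ZList.isGenerated l).fwdProd_succ (l.R_succ_ne_one 0)
  | .B l => by
    simp only [ZTerm.eval_B]
    exact (ZList.isGenerated l).bwdProd_succ (l.R_succ_ne_one 0)
  | .S r _ => by
    simp only [ZTerm.eval]
    exact isGenerated_const r

theorem ZList.isGenerated {A : Type*} : ∀ l : ZList A, IsGenerated (fun n => l.R (n + 1))
  | .single t => by
    simp only [ZList.R]
    exact ZTerm.isGenerated t
  | .cons t l => by
    simp only [ZList.R]
    exact (ZTerm.isGenerated t).mul (ZList.isGenerated l)

end

/-! ### Zigzag words are morphic -/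

theorem iterate_of_eq_mul {C : Type*} {h : FreeMonoid C →* FreeMonoid C} {z x : FreeMonoid C}
    (hz : h z = z * x) (n : ℕ) : h^[n] z = z * fwdProd (fun i => h^[i] x) n := by
  induction n with
  | zero => simp
  | succ n ih =>
    rw [Function.iterate_succ_apply, hz, iterate_map_mul, ih, fwdProd_succ, mul_assoc]

theorem IsPrefixOf.apply_eq {A : Type*} {x : FreeMonoid A} {α β : InfWord A}
    (hα : IsPrefixOf x α) (hβ : IsPrefixOf x β) {i : ℕ} (hi : i < x.length) : α i = β i :=
  (isPrefixOf_iff.1 hα i hi).symm.trans (isPrefixOf_iff.1 hβ i hi)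

theorem eq_one_of_mul_eq_one_right {A : Type*} {x y : FreeMonoid A} (h : x * y = 1) : y = 1 := by
  have := congrArg FreeMonoid.length h
  rw [FreeMonoid.length_mul, FreeMonoid.length_one] at this
  exact FreeMonoid.length_eq_zero.1 (by omega)

theorem eq_one_of_mul_eq_one_left {A : Type*} {x y : FreeMonoid A} (h : x * y = 1) : x = 1 := by
  have := congrArg FreeMonoid.length h
  rw [FreeMonoid.length_mul, FreeMonoid.length_one] at this
  exact FreeMonoid.length_eq_zero.1 (by omega)

theorem length_map {A B : Type*} (t : A → B) (x : FreeMonoid A) :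
    (FreeMonoid.map t x).length = x.length :=
  List.length_map _

theorem map_ne_one {A B : Type*} {t : A → B} {x : FreeMonoid A} :
    FreeMonoid.map t x ≠ 1 ↔ x ≠ 1 := by
  rw [Ne, Ne, ← FreeMonoid.length_eq_zero, ← FreeMonoid.length_eq_zero, length_map]

theorem IsInfConcat.isMorphicWithGrowth {A : Type*} {q : FreeMonoid A} {w : ℕ → FreeMonoid A}
    {α : InfWord A} (hα : IsInfConcat q w α) (hq : q ≠ 1) (hw : IsGenerated w)
    (hw1 : ∀ i, w i ≠ 1) :
    ∃ f : ℕ → ℕ, (∀ n ≥ 1, f n = (q * fwdProd w n).length) ∧ IsMorphicWithGrowth f α := by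
  obtain ⟨C, hC, h, t, Z, H⟩ := hw
  obtain ⟨m, s, a, r, rfl⟩ := exists_map_fin_of_mul_eq hq
  set g := markerHom h r 1 Z with hg
  set σ := markerCoding t s a with hσ
  set x := FreeMonoid.map (some ∘ Sum.inr) r * FreeMonoid.map (some ∘ Sum.inl) Z with hx
  have hnone : g (FreeMonoid.of none) = FreeMonoid.of none * x := by
    rw [hg, markerHom_none, map_one, one_mul, mul_assoc]
  have hcode : ∀ n, FreeMonoid.map σ (g^[n + 1] (FreeMonoid.of none)) =
      FreeMonoid.of a * FreeMonoid.map s r * fwdProd w (n + 1) := fun n => by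
    have h₁ : g^[n + 1] (FreeMonoid.of none) =
        g^[n + 1] (FreeMonoid.of none * FreeMonoid.map (some ∘ Sum.inr) r) := by
      rw [Function.iterate_succ_apply, Function.iterate_succ_apply, map_mul, markerHom_inr,
        mul_one]
    rw [h₁, map_iterate_markerHom]
    simp only [iterate_map_one, map_one, bwdProd_const_one, one_mul, H]
  have hx1 : ∀ i, g^[i] x ≠ 1 := fun i hi => by
    rw [hx, iterate_map_mul, iterate_markerHom_inl] at hi
    have := eq_one_of_mul_eq_one_right hi
    apply hw1 i
    rw [← H i, ← map_markerCoding_inl t s a, this, map_one]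
  obtain ⟨β, hβ⟩ := exists_isInfConcat (FreeMonoid.of none) hx1
  refine ⟨fun n => (g^[n] (FreeMonoid.of none)).length, fun n hn => ?_, Option (C ⊕ Fin m),
    inferInstance, g, none, FreeMonoid.map σ,
    ⟨⟨x, hnone, fun ⟨i, hi⟩ => hx1 i hi⟩, fun d => by rw [FreeMonoid.map_of]; rfl, β,
      ⟨x, hnone, hβ⟩, fun i => ?_⟩, fun _ => rfl⟩
  · obtain ⟨n, rfl⟩ := Nat.exists_eq_add_of_le' hn
    rw [← hcode, length_map]
  · rw [FreeMonoid.map_of]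
    congr 1
    have h₁ : IsPrefixOf (FreeMonoid.map σ (g^[i + 1] (FreeMonoid.of none))) α :=
      hcode i ▸ (isInfConcat_iff.1 hα).1 (i + 1)
    have h₂ : IsPrefixOf (g^[i + 1] (FreeMonoid.of none)) β :=
      iterate_of_eq_mul hnone (i + 1) ▸ (isInfConcat_iff.1 hβ).1 (i + 1)
    refine (h₂.map fun _ => rfl).apply_eq (α := fun i => σ (β i)) h₁ ?_
    rw [hcode, FreeMonoid.length_mul]
    have := le_length_fwdProd hw1 (i + 1)
    omega

theorem IsZigzagOfDepth.exists_isMorphicWithGrowth {A : Type*} {k : ℕ} {α : InfWord A}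
    (hα : IsZigzagOfDepth k α) :
    ∃ f : ℕ → ℕ, IsThetaPow f k ∧ IsMorphicWithGrowth f α := by
  obtain ⟨q, l, hα, rfl⟩ := hα
  obtain ⟨a, ha⟩ := l.length_fwdProd_bounds
  set W : ℕ → ℕ := fun n => (fwdProd (fun i => l.R (i + 1)) n).length with hW
  have hmono : ∀ n, W n ≤ W (n + 1) := fun n => by
    simp only [hW, fwdProd_succ, FreeMonoid.length_mul]; omega
  suffices ∃ f : ℕ → ℕ, (∀ n ≥ 1, W n ≤ f n ∧ f n ≤ q.length + W (n + 1)) ∧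
      IsMorphicWithGrowth f α by
    obtain ⟨f, hf, hm⟩ := this
    refine ⟨f, isThetaPow_of_bounds (K := a + (q.length + a * 2 ^ l.depth)) fun n hn => ?_, hm⟩
    constructor
    · calc f n ≤ q.length + W (n + 1) := (hf n hn).2
        _ ≤ q.length * n ^ l.depth + a * (2 * n) ^ l.depth := by
          gcongr
          · exact Nat.le_mul_of_pos_right _ (Nat.pow_pos hn)
          · refine (ha (n + 1)).2.trans ?_
            gcongr
            omega
        _ = (q.length + a * 2 ^ l.depth) * n ^ l.depth := by rw [mul_pow]; ring
        _ ≤ _ := Nat.mul_le_mul_right _ (Nat.le_add_left _ _)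
    · calc n ^ l.depth ≤ a * W n := (ha n).1
        _ ≤ _ := Nat.mul_le_mul (Nat.le_add_right _ _) (hf n hn).1
  have hne := l.R_succ_ne_one
  by_cases hq : q = 1
  · subst hq
    have h' := hα.shift
    rw [one_mul] at h'
    obtain ⟨f, hf, hm⟩ := h'.isMorphicWithGrowth (hne 0) l.isGenerated.shift fun i => hne _
    refine ⟨f, fun n hn => ?_, hm⟩
    rw [hf n hn, ← fwdProd_succ_left (fun i => l.R (i + 1))]
    exact ⟨hmono n, Nat.le_add_left _ _⟩
  · obtain ⟨f, hf, hm⟩ := hα.isMorphicWithGrowth hq l.isGenerated hne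
    refine ⟨f, fun n hn => ?_, hm⟩
    rw [hf n hn, FreeMonoid.length_mul]
    exact ⟨Nat.le_add_left _ _, Nat.add_le_add_left (hmono n) _⟩

/-! ### Sequences that are eventually of the form `R(l, n)` -/

/-- The sequence `w` is `R(l, 1), R(l, 2), …` for some `l`, or it consists of empty strings. -/
def IsZigzagSeq {A : Type*} (w : ℕ → FreeMonoid A) : Prop :=
  (∀ n, w n = 1) ∨ ∃ l : ZList A, ∀ n, w n = l.R (n + 1)

theorem isZigzagSeq_const {A : Type*} (r : FreeMonoid A) : IsZigzagSeq (fun _ => r) := by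
  by_cases hr : r = 1
  · exact Or.inl fun _ => hr
  · exact Or.inr ⟨.single (.S r hr), fun n => by rw [ZList.R, ZTerm.eval]⟩

theorem ZList.exists_append {A : Type*} (l' : ZList A) :
    ∀ l : ZList A, ∃ l'' : ZList A, ∀ n, l''.R n = l.R n * l'.R n
  | .single t => ⟨.cons t l', fun n => by rw [ZList.R, ZList.R]⟩
  | .cons t l => by
    obtain ⟨l'', h⟩ := ZList.exists_append l' l
    exact ⟨.cons t l'', fun n => by rw [ZList.R, ZList.R, h, mul_assoc]⟩

theorem IsZigzagSeq.mul {A : Type*} {v w : ℕ → FreeMonoid A} (hv : IsZigzagSeq v)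
    (hw : IsZigzagSeq w) : IsZigzagSeq (fun n => v n * w n) := by
  rcases hv with hv | ⟨l, hl⟩
  · simpa only [hv, one_mul] using hw
  rcases hw with hw | ⟨l', hl'⟩
  · exact Or.inr ⟨l, fun n => by beta_reduce; rw [hw, mul_one, hl]⟩
  · obtain ⟨l'', h⟩ := l'.exists_append l
    exact Or.inr ⟨l'', fun n => by beta_reduce; rw [h, hl, hl']⟩

theorem IsZigzagSeq.fwdProd_succ {A : Type*} {w : ℕ → FreeMonoid A} (hw : IsZigzagSeq w) :
    IsZigzagSeq (fun n => fwdProd w (n + 1)) := by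
  rcases hw with hw | ⟨l, hl⟩
  · refine Or.inl fun n => ?_
    beta_reduce
    rw [funext hw, fwdProd_const_one]
  · refine Or.inr ⟨.single (.F l), fun n => ?_⟩
    rw [ZList.R, ZTerm.eval_F, funext hl]

theorem IsZigzagSeq.bwdProd_succ {A : Type*} {w : ℕ → FreeMonoid A} (hw : IsZigzagSeq w) :
    IsZigzagSeq (fun n => bwdProd w (n + 1)) := by
  rcases hw with hw | ⟨l, hl⟩
  · refine Or.inl fun n => ?_
    beta_reduce
    rw [funext hw, bwdProd_const_one]
  · refine Or.inr ⟨.single (.B l), fun n => ?_⟩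
    rw [ZList.R, ZTerm.eval_B, funext hl]

/-- All sufficiently late tails of the sequence `w` are zigzag sequences. -/
def IsEventuallyZigzag {A : Type*} (w : ℕ → FreeMonoid A) : Prop :=
  ∃ N, ∀ M ≥ N, IsZigzagSeq (fun n => w (M + n))

theorem isEventuallyZigzag_const {A : Type*} (r : FreeMonoid A) :
    IsEventuallyZigzag (fun _ => r) :=
  ⟨0, fun _ _ => isZigzagSeq_const r⟩

theorem IsEventuallyZigzag.mul {A : Type*} {v w : ℕ → FreeMonoid A} (hv : IsEventuallyZigzag v)
    (hw : IsEventuallyZigzag w) : IsEventuallyZigzag (fun n => v n * w n) := by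
  obtain ⟨N, hN⟩ := hv
  obtain ⟨N', hN'⟩ := hw
  exact ⟨max N N', fun M hM =>
    (hN M ((le_max_left _ _).trans hM)).mul (hN' M ((le_max_right _ _).trans hM))⟩

theorem IsEventuallyZigzag.of_shift {A : Type*} {w : ℕ → FreeMonoid A}
    (hw : IsEventuallyZigzag (fun n => w (n + 1))) : IsEventuallyZigzag w := by
  obtain ⟨N, hN⟩ := hw
  refine ⟨N + 1, fun M hM => ?_⟩
  obtain ⟨M, rfl⟩ := Nat.exists_eq_add_of_le' (le_of_add_le_right hM)
  simpa only [add_right_comm] using hN M (by omega)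

theorem IsEventuallyZigzag.fwdProd {A : Type*} {w : ℕ → FreeMonoid A}
    (hw : IsEventuallyZigzag w) : IsEventuallyZigzag (fwdProd w) := by
  obtain ⟨N, hN⟩ := hw
  refine ⟨N + 1, fun M hM => ?_⟩
  obtain ⟨M, rfl⟩ := Nat.exists_eq_add_of_le' (le_of_add_le_right hM)
  have e : ∀ n, ZigzagWords.fwdProd w (M + 1 + n) =
      ZigzagWords.fwdProd w M * ZigzagWords.fwdProd (fun i => w (M + i)) (n + 1) := fun n => by
    rw [← fwdProd_add, add_assoc, add_comm 1 n]
  simp only [e]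
  exact (isZigzagSeq_const _).mul (hN M (by omega)).fwdProd_succ

theorem IsEventuallyZigzag.bwdProd {A : Type*} {w : ℕ → FreeMonoid A}
    (hw : IsEventuallyZigzag w) : IsEventuallyZigzag (bwdProd w) := by
  obtain ⟨N, hN⟩ := hw
  refine ⟨N + 1, fun M hM => ?_⟩
  obtain ⟨M, rfl⟩ := Nat.exists_eq_add_of_le' (le_of_add_le_right hM)
  have e : ∀ n, ZigzagWords.bwdProd w (M + 1 + n) =
      ZigzagWords.bwdProd (fun i => w (M + i)) (n + 1) * ZigzagWords.bwdProd w M := fun n => by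
    rw [← bwdProd_add, add_assoc, add_comm 1 n]
  simp only [e]
  exact (hN M (by omega)).bwdProd_succ.mul (isZigzagSeq_const _)

/-! ### Occurrences of letters in iterates of a morphism -/

section Occurrences

variable {C : Type*} {h : FreeMonoid C →* FreeMonoid C}

theorem exists_eq_mul_of_mem {a : C} {z : FreeMonoid C} (ha : a ∈ z) :
    ∃ u v, z = u * FreeMonoid.of a * v := by
  obtain ⟨u, v, e⟩ := List.append_of_mem (a := a) (l := z.toList) ha
  refine ⟨FreeMonoid.ofList u, FreeMonoid.ofList v, ?_⟩
  rw [mul_assoc, ← FreeMonoid.ofList_cons, ← FreeMonoid.ofList_append, ← e,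
    FreeMonoid.ofList_toList]

theorem mem_iterate_of_mem {a b : C} {z : FreeMonoid C} {m : ℕ} (hb : b ∈ z)
    (ha : a ∈ h^[m] (FreeMonoid.of b)) : a ∈ h^[m] z := by
  obtain ⟨u, v, rfl⟩ := exists_eq_mul_of_mem hb
  rw [iterate_map_mul, iterate_map_mul, FreeMonoid.mem_mul, FreeMonoid.mem_mul]
  exact Or.inl (Or.inr ha)

theorem mem_iterate_add {a b : C} {z : FreeMonoid C} {m n : ℕ} (hb : b ∈ h^[n] z)
    (ha : a ∈ h^[m] (FreeMonoid.of b)) : a ∈ h^[m + n] z := by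
  rw [Function.iterate_add_apply]
  exact mem_iterate_of_mem hb ha

theorem mem_iterate_mul {a : C} {n : ℕ} (ha : a ∈ h^[n] (FreeMonoid.of a)) (m : ℕ) :
    a ∈ h^[n * m] (FreeMonoid.of a) := by
  induction m with
  | zero => exact FreeMonoid.mem_of_self
  | succ m ih => rw [mul_add, mul_one, add_comm]; exact mem_iterate_add ih ha

theorem length_iterate_le_of_mem {a : C} {z : FreeMonoid C} (ha : a ∈ z) (m : ℕ) :
    (h^[m] (FreeMonoid.of a)).length ≤ (h^[m] z).length := by
  obtain ⟨u, v, rfl⟩ := exists_eq_mul_of_mem ha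
  rw [iterate_map_mul, iterate_map_mul, FreeMonoid.length_mul, FreeMonoid.length_mul]
  omega

theorem two_pow_le_length_iterate {d : C} {n : ℕ} {u v : FreeMonoid C}
    (hd : h^[n] (FreeMonoid.of d) = u * FreeMonoid.of d * v) (huv : d ∈ u ∨ d ∈ v) (j : ℕ) :
    2 ^ j ≤ (h^[n * j] (FreeMonoid.of d)).length := by
  induction j with
  | zero => simp
  | succ j ih =>
    rw [mul_add, mul_one, Function.iterate_add_apply, hd, iterate_map_mul, iterate_map_mul,
      FreeMonoid.length_mul, FreeMonoid.length_mul, pow_succ]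
    rcases huv with hu | hv
    · have := length_iterate_le_of_mem (h := h) hu (n * j)
      omega
    · have := length_iterate_le_of_mem (h := h) hv (n * j)
      omega

/-- If `|hⁿ(c)|` is polynomially bounded, then a letter that is accessible from `c` occurs at most
once in each of its iterated images. -/
theorem notMem_of_polynomial_growth {c : C} {K k N : ℕ}
    (hK : ∀ n ≥ N, (h^[n] (FreeMonoid.of c)).length ≤ K * n ^ k) {d : C} {t : ℕ}
    (hd : d ∈ h^[t] (FreeMonoid.of c)) {n : ℕ} (hn : 1 ≤ n) {u v : FreeMonoid C}
    (e : h^[n] (FreeMonoid.of d) = u * FreeMonoid.of d * v) : d ∉ u ∧ d ∉ v := by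
  by_contra! huv
  have huv : d ∈ u ∨ d ∈ v := or_iff_not_imp_left.2 huv
  obtain ⟨i, hi⟩ : ∃ i ≥ N, d ∈ h^[i] (FreeMonoid.of c) := by
    refine ⟨n * N + t, (Nat.le_mul_of_pos_left N hn).trans (Nat.le_add_right _ _),
      mem_iterate_add hd (mem_iterate_mul ?_ N)⟩
    rw [e, FreeMonoid.mem_mul, FreeMonoid.mem_mul]
    exact Or.inl (Or.inr FreeMonoid.mem_of_self)
  obtain ⟨j, hj1, hj⟩ := exists_mul_pow_lt_two_pow (K * (n + i) ^ k) k
  refine absurd ?_ (not_le.2 hj)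
  calc 2 ^ j ≤ (h^[n * j] (FreeMonoid.of d)).length := two_pow_le_length_iterate e huv j
    _ ≤ (h^[n * j] (h^[i] (FreeMonoid.of c))).length := length_iterate_le_of_mem hi.2 _
    _ = (h^[n * j + i] (FreeMonoid.of c)).length := by rw [Function.iterate_add_apply]
    _ ≤ K * (n * j + i) ^ k := hK _ (hi.1.trans (Nat.le_add_left _ _))
    _ ≤ K * ((n + i) * j) ^ k := by
      gcongr
      rw [add_mul]
      exact Nat.add_le_add_left (Nat.le_mul_of_pos_right _ hj1) _
    _ = K * (n + i) ^ k * j ^ k := by rw [mul_pow, mul_assoc]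

/-- Some power of a morphism over a finite alphabet has only periods of length one. -/
theorem exists_common_period [Finite C] (h : FreeMonoid C →* FreeMonoid C) :
    ∃ p ≥ 1, ∀ d, (∃ n ≥ 1, d ∈ h^[n] (FreeMonoid.of d)) → d ∈ h^[p] (FreeMonoid.of d) := by
  classical
  have := Fintype.ofFinite C
  have H : ∀ d, ∃ n ≥ 1, (∃ n ≥ 1, d ∈ h^[n] (FreeMonoid.of d)) → d ∈ h^[n] (FreeMonoid.of d) := by
    intro d
    by_cases hd : ∃ n ≥ 1, d ∈ h^[n] (FreeMonoid.of d)
    · obtain ⟨n, hn, hd'⟩ := hd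
      exact ⟨n, hn, fun _ => hd'⟩
    · exact ⟨1, le_rfl, fun h' => absurd h' hd⟩
  choose n hn hd using H
  refine ⟨∏ d, n d, Nat.one_le_iff_ne_zero.2 (Finset.prod_ne_zero_iff.2 fun d _ =>
    Nat.one_le_iff_ne_zero.1 (hn d)), fun d h' => ?_⟩
  obtain ⟨m, hm⟩ := Finset.dvd_prod_of_mem n (Finset.mem_univ d)
  rw [hm]
  exact mem_iterate_mul (hd d h') m

end Occurrences

theorem iterate_of_eq_mul_mul {C : Type*} {g : FreeMonoid C →* FreeMonoid C}
    {z u v : FreeMonoid C} (hz : g z = u * z * v) (n : ℕ) :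
    g^[n] z = bwdProd (fun i => g^[i] u) n * z * fwdProd (fun i => g^[i] v) n := by
  induction n with
  | zero => simp
  | succ n ih =>
    rw [Function.iterate_succ_apply, hz, iterate_map_mul, iterate_map_mul, ih, fwdProd_succ,
      bwdProd_succ]
    simp only [mul_assoc]

theorem isEventuallyZigzag_iterate_of_letters {C A : Type*} {g : FreeMonoid C →* FreeMonoid C}
    {σ : FreeMonoid C →* FreeMonoid A} {z : FreeMonoid C}
    (hz : ∀ d ∈ z, IsEventuallyZigzag (fun n => σ (g^[n] (FreeMonoid.of d)))) :
    IsEventuallyZigzag (fun n => σ (g^[n] z)) := by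
  induction z using FreeMonoid.inductionOn' with
  | one => simpa only [iterate_map_one, map_one] using isEventuallyZigzag_const 1
  | of_mul d z ih =>
    simp only [iterate_map_mul, map_mul]
    exact (hz d (FreeMonoid.mem_mul.2 (Or.inl FreeMonoid.mem_of_self))).mul
      (ih fun e he => hz e (FreeMonoid.mem_mul.2 (Or.inr he)))

/-- If each letter of `z` either never recurs in its images under `g` or occurs exactly once in
each of them, then the sequence `z, g z, g² z, …` is eventually zigzag. -/
theorem isEventuallyZigzag_iterate {C A : Type*} [Finite C] {g : FreeMonoid C →* FreeMonoid C}
    (σ : FreeMonoid C →* FreeMonoid A) {P : C → Prop}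
    (hP : ∀ d, P d → ∀ e ∈ g (FreeMonoid.of d), P e)
    (hper : ∀ d, (∃ n ≥ 1, d ∈ g^[n] (FreeMonoid.of d)) → d ∈ g (FreeMonoid.of d))
    (honce : ∀ d, P d → ∀ n ≥ 1, ∀ u v, g^[n] (FreeMonoid.of d) = u * FreeMonoid.of d * v →
      d ∉ u ∧ d ∉ v) {z : FreeMonoid C} (hz : ∀ d ∈ z, P d) :
    IsEventuallyZigzag (fun n => σ (g^[n] z)) := by
  let lt : C → C → Prop := fun e d =>
    (∃ n, e ∈ g^[n] (FreeMonoid.of d)) ∧ ¬ ∃ n, d ∈ g^[n] (FreeMonoid.of e)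
  have hwf : WellFounded lt := by
    have : IsTrans C lt := ⟨fun a b c ⟨⟨m, hm⟩, h₁⟩ ⟨⟨n, hn⟩, _⟩ =>
      ⟨⟨m + n, mem_iterate_add hn hm⟩, fun ⟨i, hi⟩ => h₁ ⟨n + i, mem_iterate_add hi hn⟩⟩⟩
    have : Std.Irrefl lt := ⟨fun a h => h.2 h.1⟩
    exact Finite.wellFounded_of_trans_of_irrefl lt
  refine isEventuallyZigzag_iterate_of_letters fun d hd => ?_
  replace hd := hz d hd
  clear hz
  induction d using hwf.induction with
  | _ d ih =>
  by_cases hrec : ∃ n ≥ 1, d ∈ g^[n] (FreeMonoid.of d)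
  · obtain ⟨u, v, e⟩ := exists_eq_mul_of_mem (hper d hrec)
    have hside : ∀ b, b ∈ u ∨ b ∈ v →
        IsEventuallyZigzag (fun n => σ (g^[n] (FreeMonoid.of b))) := by
      intro b hb
      have hbd : b ∈ g (FreeMonoid.of d) := by
        rw [e, FreeMonoid.mem_mul, FreeMonoid.mem_mul]
        tauto
      refine ih b ⟨⟨1, hbd⟩, fun ⟨n, hn⟩ => ?_⟩ (hP d hd b hbd)
      obtain ⟨u', v', e'⟩ := exists_eq_mul_of_mem (mem_iterate_mul (n := 1) (hper d hrec) n)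
      rw [one_mul] at e'
      have e'' : g^[n + 1] (FreeMonoid.of d) =
          (g^[n] u * u') * FreeMonoid.of d * (v' * g^[n] v) := by
        rw [Function.iterate_succ_apply, e, iterate_map_mul, iterate_map_mul, e']
        simp only [mul_assoc]
      have := honce d hd (n + 1) (Nat.le_add_left _ _) _ _ e''
      rw [FreeMonoid.mem_mul, FreeMonoid.mem_mul] at this
      rcases hb with hb | hb
      · exact this.1 (Or.inl (mem_iterate_of_mem hb hn))
      · exact this.2 (Or.inr (mem_iterate_of_mem hb hn))
    simp only [iterate_of_eq_mul_mul e, map_mul, map_bwdProd, map_fwdProd]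
    exact ((isEventuallyZigzag_iterate_of_letters fun b hb => hside b (Or.inl hb)).bwdProd.mul
      (isEventuallyZigzag_const _)).mul
      (isEventuallyZigzag_iterate_of_letters fun b hb => hside b (Or.inr hb)).fwdProd
  · refine IsEventuallyZigzag.of_shift ?_
    simp only [Function.iterate_succ_apply]
    refine isEventuallyZigzag_iterate_of_letters fun b hb => ih b ⟨⟨1, hb⟩, fun ⟨n, hn⟩ => ?_⟩
      (hP d hd b hb)
    exact hrec ⟨n + 1, Nat.le_add_left _ _, mem_iterate_add (n := 1) hb hn⟩

/-! ### Morphic words of polynomial growth are zigzag words -/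

theorem IsCoding.exists_eq_map {C A : Type*} {τ : FreeMonoid C →* FreeMonoid A}
    (hτ : IsCoding τ) : ∃ t : C → A, τ = FreeMonoid.map t := by
  choose t ht using fun d => FreeMonoid.length_eq_one.1 (hτ d)
  exact ⟨t, FreeMonoid.hom_eq ht⟩

theorem IsMorphicWithGrowth.isZigzagOfDepth {A : Type*} {k : ℕ} {f : ℕ → ℕ} {α : InfWord A}
    (hα : IsMorphicWithGrowth f α) (hf : IsThetaPow f k) : IsZigzagOfDepth k α := by
  obtain ⟨C, hC, h, c, τ, ⟨⟨x, hx, himm⟩, hτ, β, ⟨x', hx', hβ⟩, hβα⟩, hlen⟩ := hα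
  obtain rfl : x' = x := mul_left_cancel (hx'.symm.trans hx)
  obtain ⟨t, rfl⟩ := hτ.exists_eq_map
  have hβα : ∀ i, t (β i) = α i := fun i => FreeMonoid.of_injective (hβα i)
  obtain ⟨K, N, hK⟩ := hf.exists_bounds
  obtain ⟨p, hp, hper⟩ := exists_common_period h
  obtain ⟨g, hg⟩ : ∃ g : FreeMonoid C →* FreeMonoid C, ∀ z, g z = h^[p] z :=
    ⟨⟨⟨h^[p], iterate_map_one h p⟩, iterate_map_mul h p⟩, fun _ => rfl⟩
  have hgn : ∀ n z, g^[n] z = h^[p * n] z := fun n z => by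
    rw [Function.iterate_mul, show (g : FreeMonoid C → FreeMonoid C) = h^[p] from funext hg]
  set y := fwdProd (fun i => h^[i] x') p with hy
  have hgc : g (FreeMonoid.of c) = FreeMonoid.of c * y := by rw [hg, iterate_of_eq_mul hx]
  obtain ⟨M, hM⟩ : IsEventuallyZigzag (fun n => FreeMonoid.map t (g^[n] y)) := by
    refine isEventuallyZigzag_iterate (FreeMonoid.map t)
      (P := fun d => ∃ m, d ∈ h^[m] (FreeMonoid.of c)) ?_ ?_ ?_ ?_
    · rintro d ⟨m, hm⟩ e he
      rw [hg] at he
      exact ⟨_, mem_iterate_add hm he⟩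
    · rintro d ⟨n, hn, hd⟩
      rw [hgn] at hd
      rw [hg]
      exact hper d ⟨p * n, Nat.mul_pos hp hn, hd⟩
    · rintro d ⟨m, hm⟩ n hn u v e
      rw [hgn] at e
      exact notMem_of_polynomial_growth (fun n hn => (hlen n).trans_le (hK n hn).1) hm
        (Nat.mul_pos hp hn) e
    · intro d hd
      refine ⟨p, ?_⟩
      rw [← hg, hgc]
      exact FreeMonoid.mem_mul.2 (Or.inr hd)
  have hyne : ∀ n, g^[n] y ≠ 1 := fun n hn => by
    obtain ⟨p, rfl⟩ := Nat.exists_eq_add_of_le' hp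
    rw [hy, fwdProd_succ_left, iterate_map_mul] at hn
    exact himm ⟨_, (hgn n x').symm.trans (eq_one_of_mul_eq_one_left hn)⟩
  obtain ⟨l, hl⟩ := (hM M le_rfl).resolve_left fun h1 => map_ne_one.2 (hyne _) (h1 0)
  have key : ∀ m, FreeMonoid.map t (g^[M] (FreeMonoid.of c)) * fwdProd (fun i => l.R (i + 1)) m =
      FreeMonoid.map t (h^[p * (M + m)] (FreeMonoid.of c)) := fun m => by
    rw [← hgn, iterate_of_eq_mul hgc (M + m), fwdProd_add, ← mul_assoc, ← iterate_of_eq_mul hgc,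
      map_mul, map_fwdProd, funext hl]
  refine ⟨FreeMonoid.map t (g^[M] (FreeMonoid.of c)), l, isInfConcat_iff.2 ⟨fun m => ?_,
    fun m => ⟨m, ?_⟩⟩, ?_⟩
  · rw [key, iterate_of_eq_mul hx]
    exact ((isInfConcat_iff.1 hβ).1 _).map hβα
  · rw [FreeMonoid.length_mul]
    exact (le_length_fwdProd l.R_succ_ne_one m).trans (Nat.le_add_left _ _)
  · obtain ⟨a, ha⟩ := l.length_fwdProd_bounds
    set q := FreeMonoid.map t (g^[M] (FreeMonoid.of c)) with hq
    have hfm : ∀ m, f (p * (M + m)) =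
        q.length + (fwdProd (fun i => l.R (i + 1)) m).length := fun m => by
      rw [← FreeMonoid.length_mul, key, length_map, hlen]
    have hlarge : ∀ m ≥ N, p * (M + m) ≥ N := fun m hm =>
      (hm.trans (Nat.le_add_left _ _)).trans (Nat.le_mul_of_pos_left _ hp)
    apply le_antisymm
    · refine le_of_pow_le_mul_pow (K := a * (K * (p * (M + 1)) ^ k)) (N := max N 1) fun m hm => ?_
      have hm1 : 1 ≤ m := (le_max_right _ _).trans hm
      calc m ^ l.depth ≤ a * (fwdProd (fun i => l.R (i + 1)) m).length := (ha m).1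
        _ ≤ a * f (p * (M + m)) := by rw [hfm]; gcongr; omega
        _ ≤ a * (K * (p * (M + m)) ^ k) := by
          gcongr
          exact (hK _ (hlarge m ((le_max_left _ _).trans hm))).1
        _ ≤ a * (K * (p * ((M + 1) * m)) ^ k) := by
          gcongr
          nlinarith
        _ = a * (K * (p * (M + 1)) ^ k) * m ^ k := by rw [← mul_assoc p, mul_pow _ m]; ring
    · refine le_of_pow_le_mul_pow (K := K * (q.length + a)) (N := max N 1) fun m hm => ?_
      have hm1 : 1 ≤ m := (le_max_right _ _).trans hm
      calc m ^ k ≤ (p * (M + m)) ^ k := by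
            gcongr
            exact (Nat.le_add_left _ _).trans (Nat.le_mul_of_pos_left _ hp)
        _ ≤ K * f (p * (M + m)) := (hK _ (hlarge m ((le_max_left _ _).trans hm))).2
        _ ≤ K * (q.length * m ^ l.depth + a * m ^ l.depth) := by
          rw [hfm]
          gcongr
          · exact Nat.le_mul_of_pos_right _ (Nat.pow_pos hm1)
          · exact (ha m).2
        _ = K * (q.length + a) * m ^ l.depth := by ring

end ZigzagWords

theorem theorem3 {A : Type*} [Finite A] (k : ℕ) (α : ZigzagWords.InfWord A) :
    (∃ f : ℕ → ℕ, ZigzagWords.IsThetaPow f k ∧ ZigzagWords.IsMorphicWithGrowth f α) ↔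
      ZigzagWords.IsZigzagOfDepth k α :=
  ⟨fun ⟨_, hf, hα⟩ => hα.isZigzagOfDepth hf, fun hα => hα.exists_isMorphicWithGrowth⟩
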